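/- Let $k$ be a fixed positive integer. For each positive integer $n$ let $b_k(n)$ be the number of balanced $2k \times 2n$ $0$-$1$ matrices, i.e., matrices with entries in $\{0,1\}$, with $2k$ rows and $2n$ columns, in which every row has exactly $n$ ones (and hence exactly $n$ zeroes) and every column has exactly $k$ ones (and hence exactly $k$ zeroes). Then the sequence $\{b_k(n)\}_{n=1}^{\infty}$ is holonomic (P-recursive). In other words, there exist a positive integer $L$ (the order) and polynomials $p_0, p_1, \dots, p_L$ with rational coefficients, with $p_L$ not the zero polynomial, such that $$\sum_{i=0}^{L} p_i(n)\, b_k(n+i) = 0 \qquad \text{for all integers } n \geq 1.$$ -/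

import Mathlib

open Polynomial

/-- A `2k × 2n` matrix with entries in `{0, 1}` is balanced if every row has exactly `n` ones
and every column has exactly `k` ones. -/
def IsBalanced (k n : ℕ) (A : Matrix (Fin (2 * k)) (Fin (2 * n)) (Fin 2)) : Prop :=
  (∀ i, (Finset.univ.filter fun j => A i j = 1).card = n) ∧
    ∀ j, (Finset.univ.filter fun i => A i j = 1).card = k

instance (k n : ℕ) : DecidablePred (IsBalanced k n) := fun A => by
  unfold IsBalanced
  infer_instance

/-- `balancedCount k n` is the number of balanced `2k × 2n` matrices with entries in `{0, 1}`. -/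
def balancedCount (k n : ℕ) : ℕ :=
  (Finset.univ.filter fun A : Matrix (Fin (2 * k)) (Fin (2 * n)) (Fin 2) => IsBalanced k n A).card

/-- The sequence `a 1, a 2, a 3, …` is holonomic (P-recursive): it satisfies a linear recurrence
of some positive order `L` with polynomial coefficients, valid for all `n ≥ 1`, whose leading
coefficient is not the zero polynomial. (The value `a 0` plays no role.) -/
def IsHolonomic (a : ℕ → ℚ) : Prop :=
  ∃ L : ℕ, 0 < L ∧ ∃ p : ℕ → ℚ[X], p L ≠ 0 ∧
    ∀ n : ℕ, 1 ≤ n → ∑ i ∈ Finset.range (L + 1), (p i).eval (n : ℚ) * a (n + i) = 0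

/-- The families `ℕ → MvPolynomial σ ℚ` that are polynomial in the index, of degree at most `e`,
with coefficients of degree at most `d` in each variable. -/
noncomputable def polyFamilies (σ : Type*) (d e : ℕ) : Submodule ℚ (ℕ → MvPolynomial σ ℚ) :=
  Submodule.span ℚ {g | ∃ j ≤ e, ∃ s : σ →₀ ℕ, (∀ l, s l ≤ d) ∧
    g = fun n : ℕ => MvPolynomial.monomial s ((n : ℚ) ^ j)}

/-! ### Dimension and closure properties of polynomial families -/

namespace polyFamilies

variable {σ : Type*}

theorem mono {d d' e e' : ℕ} (hd : d ≤ d') (he : e ≤ e') :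
    polyFamilies σ d e ≤ polyFamilies σ d' e' := by
  apply Submodule.span_mono
  rintro g ⟨j, hj, s, hs, rfl⟩
  exact ⟨j, hj.trans he, s, fun l => (hs l).trans hd, rfl⟩

theorem monomial_mem {d e j : ℕ} (hj : j ≤ e) {s : σ →₀ ℕ} (hs : ∀ l, s l ≤ d) :
    (fun n : ℕ => MvPolynomial.monomial s ((n : ℚ) ^ j)) ∈ polyFamilies σ d e :=
  Submodule.subset_span ⟨j, hj, s, hs, rfl⟩

theorem finrank_le [Fintype σ] (d e : ℕ) :
    FiniteDimensional ℚ (polyFamilies σ d e) ∧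
      Module.finrank ℚ (polyFamilies σ d e) ≤ (e + 1) * (d + 1) ^ Fintype.card σ := by
  classical
  let f : Fin (e + 1) × (σ → Fin (d + 1)) → ℕ → MvPolynomial σ ℚ := fun x n =>
    MvPolynomial.monomial (Finsupp.equivFunOnFinite.symm fun l => (x.2 l : ℕ))
      ((n : ℚ) ^ (x.1 : ℕ))
  have h : polyFamilies σ d e = Submodule.span ℚ (Set.range f) := by
    apply le_antisymm
    · apply Submodule.span_mono
      rintro g ⟨j, hj, s, hs, rfl⟩
      refine ⟨(⟨j, by omega⟩, fun l => ⟨s l, Nat.lt_succ_of_le (hs l)⟩), ?_⟩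
      have : (Finsupp.equivFunOnFinite.symm fun l => s l) = s := by ext; simp
      simp [f, this]
    · rw [Submodule.span_le]
      rintro _ ⟨x, rfl⟩
      exact monomial_mem (by omega) fun l => by simpa using Nat.le_of_lt_succ (x.2 l).2
  rw [h]
  refine ⟨FiniteDimensional.span_of_finite ℚ (Set.finite_range f), ?_⟩
  refine (finrank_range_le_card f).trans (le_of_eq ?_)
  simp

theorem map_mem {d e d' e' : ℕ} (T : (ℕ → MvPolynomial σ ℚ) →ₗ[ℚ] (ℕ → MvPolynomial σ ℚ))
    (hT : ∀ j ≤ e, ∀ s : σ →₀ ℕ, (∀ l, s l ≤ d) →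
      T (fun n : ℕ => MvPolynomial.monomial s ((n : ℚ) ^ j)) ∈ polyFamilies σ d' e')
    {R : ℕ → MvPolynomial σ ℚ} (hR : R ∈ polyFamilies σ d e) : T R ∈ polyFamilies σ d' e' := by
  have : polyFamilies σ d e ≤ (polyFamilies σ d' e').comap T := by
    refine Submodule.span_le.2 ?_
    rintro g ⟨j, hj, s, hs, rfl⟩
    exact hT j hj s hs
  exact this hR

theorem mul_mem {d e q : ℕ} {Q : MvPolynomial σ ℚ} (hQ : ∀ m ∈ Q.support, ∀ l, m l ≤ q)
    {R : ℕ → MvPolynomial σ ℚ} (hR : R ∈ polyFamilies σ d e) :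
    (fun n => Q * R n) ∈ polyFamilies σ (d + q) e := by
  refine map_mem ((LinearMap.mulLeft ℚ Q).compLeft ℕ) ?_ hR
  intro j hj s hs
  have : (LinearMap.mulLeft ℚ Q).compLeft ℕ
      (fun n : ℕ => MvPolynomial.monomial s ((n : ℚ) ^ j)) =
      ∑ m ∈ Q.support, Q.coeff m •
        fun n : ℕ => MvPolynomial.monomial (m + s) ((n : ℚ) ^ j) := by
    funext n
    simp only [LinearMap.compLeft_apply, Function.comp, LinearMap.mulLeft_apply,
      Finset.sum_apply, Pi.smul_apply]
    conv_lhs => rw [Q.as_sum, Finset.sum_mul]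
    refine Finset.sum_congr rfl fun m _ => ?_
    rw [MvPolynomial.monomial_mul, MvPolynomial.smul_monomial, smul_eq_mul]
  rw [this]
  refine Submodule.sum_mem _ fun m hm => Submodule.smul_mem _ _ (monomial_mem hj fun l => ?_)
  have := hQ m hm l
  have := hs l
  simp only [Finsupp.add_apply]
  omega

theorem index_smul_mem {d e : ℕ} {R : ℕ → MvPolynomial σ ℚ} (hR : R ∈ polyFamilies σ d e) :
    (fun n : ℕ => (n : ℚ) • R n) ∈ polyFamilies σ d (e + 1) := by
  refine map_mem (LinearMap.pi fun n : ℕ => (n : ℚ) • LinearMap.proj n) ?_ hR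
  intro j hj s hs
  convert monomial_mem (d := d) (Nat.succ_le_succ hj) hs using 1
  funext n
  simp [MvPolynomial.smul_monomial, pow_succ']

end polyFamilies

/-! ### Euler operators acting on powers of `Q` -/

/-- The Euler operator `X l * ∂ / ∂ X l`. -/
noncomputable def eulerOp {σ : Type*} (l : σ) (p : MvPolynomial σ ℚ) : MvPolynomial σ ℚ :=
  MvPolynomial.X l * MvPolynomial.pderiv l p

section Euler

variable {σ : Type*}

theorem eulerOp_monomial (l : σ) (s : σ →₀ ℕ) (a : ℚ) :
    eulerOp l (MvPolynomial.monomial s a) = MvPolynomial.monomial s (s l * a) := by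
  classical
  unfold eulerOp
  rw [MvPolynomial.pderiv_monomial, MvPolynomial.X, MvPolynomial.monomial_mul, one_mul]
  by_cases h : s l = 0
  · simp [h]
  · rw [mul_comm a]
    rw [add_tsub_cancel_of_le (Finsupp.single_le_iff.2 (Nat.one_le_iff_ne_zero.2 h))]

theorem coeff_eulerOp (l : σ) (p : MvPolynomial σ ℚ) (v : σ →₀ ℕ) :
    (eulerOp l p).coeff v = v l * p.coeff v := by
  classical
  induction p using MvPolynomial.induction_on' with
  | monomial s a =>
    rw [eulerOp_monomial, MvPolynomial.coeff_monomial, MvPolynomial.coeff_monomial]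
    split_ifs with h
    · rw [h]
    · simp
  | add p q hp hq =>
    have : eulerOp l (p + q) = eulerOp l p + eulerOp l q := by simp [eulerOp, mul_add]
    rw [this, MvPolynomial.coeff_add, MvPolynomial.coeff_add, hp, hq, mul_add]

theorem eulerOp_pow_mul (l : σ) (Q R : MvPolynomial σ ℚ) (n : ℕ) :
    eulerOp l (Q ^ (n + 1) * R) =
      Q ^ n * (((n : ℚ) + 1) • (eulerOp l Q * R) + Q * eulerOp l R) := by
  simp only [eulerOp, MvPolynomial.pderiv_mul, MvPolynomial.pderiv_pow, MvPolynomial.smul_eq_C_mul]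
  simp only [Nat.add_sub_cancel, Nat.cast_add, Nat.cast_one, map_add, map_one, map_natCast]
  ring

theorem polyFamilies.eulerOp_mem {d e : ℕ} (l : σ) {R : ℕ → MvPolynomial σ ℚ}
    (hR : R ∈ polyFamilies σ d e) : (fun n => eulerOp l (R n)) ∈ polyFamilies σ d e := by
  refine map_mem (((LinearMap.mulLeft ℚ (MvPolynomial.X l)).comp
    (MvPolynomial.pderiv (R := ℚ) l).toLinearMap).compLeft ℕ) ?_ hR
  intro j hj s hs
  convert Submodule.smul_mem _ (s l : ℚ) (monomial_mem (d := d) hj hs) using 1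
  funext n
  rw [Pi.smul_apply, MvPolynomial.smul_monomial, smul_eq_mul]
  exact eulerOp_monomial l s ((n : ℚ) ^ j)

variable {d e q : ℕ} {Q : MvPolynomial σ ℚ} {R : ℕ → MvPolynomial σ ℚ}

/-- By the product rule, `eulerOp l - (n + c)` costs only one power of `Q`, one degree in `n` and
`q` in each variable. -/
theorem exists_family_eulerOp_sub (hQ : ∀ m ∈ Q.support, ∀ l, m l ≤ q)
    (hR : R ∈ polyFamilies σ d e) (l : σ) (c : ℚ) (s : ℕ) :
    ∃ R' ∈ polyFamilies σ (d + q) (e + 1), ∀ (n : ℕ) (v : σ →₀ ℕ),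
      (Q ^ (n + s) * R' n).coeff v =
        ((v l : ℚ) - (n + c)) * (Q ^ (n + s + 1) * R n).coeff v := by
  have hθQ : ∀ m ∈ (eulerOp l Q).support, ∀ l, m l ≤ q := by
    intro m hm
    refine hQ m ?_
    rw [MvPolynomial.mem_support_iff, coeff_eulerOp] at hm
    exact MvPolynomial.mem_support_iff.2 (right_ne_zero_of_mul hm)
  have h1 := polyFamilies.mul_mem hθQ hR
  have h2 := polyFamilies.mul_mem hQ (polyFamilies.eulerOp_mem l hR)
  have h3 := polyFamilies.mul_mem hQ hR
  have up : polyFamilies σ (d + q) e ≤ polyFamilies σ (d + q) (e + 1) :=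
    polyFamilies.mono le_rfl (Nat.le_succ e)
  refine ⟨_, Submodule.sub_mem _ (Submodule.add_mem _ (Submodule.add_mem _
    (polyFamilies.index_smul_mem h1) (Submodule.smul_mem _ ((s : ℚ) + 1) (up h1))) (up h2))
    (Submodule.add_mem _ (polyFamilies.index_smul_mem h3) (Submodule.smul_mem _ c (up h3))), ?_⟩
  intro n v
  rw [sub_mul, ← coeff_eulerOp, eulerOp_pow_mul, ← smul_eq_mul ((n : ℚ) + c), ← MvPolynomial.coeff_smul,
    ← MvPolynomial.coeff_sub]
  congr 1
  simp only [Pi.sub_apply, Pi.add_apply, Pi.smul_apply, MvPolynomial.smul_eq_C_mul, map_add,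
    map_natCast, map_one, Nat.cast_add]
  ring

theorem exists_family_prod_eulerOp_sub {ι : Type*} (hQ : ∀ m ∈ Q.support, ∀ l, m l ≤ q)
    (T : Finset ι) (l : ι → σ) (c : ι → ℚ) (s : ℕ) (hR : R ∈ polyFamilies σ d e) :
    ∃ R' ∈ polyFamilies σ (d + q * T.card) (e + T.card), ∀ (n : ℕ) (v : σ →₀ ℕ),
      (Q ^ (n + s) * R' n).coeff v =
        (∏ x ∈ T, ((v (l x) : ℚ) - (n + c x))) * (Q ^ (n + s + T.card) * R n).coeff v := by
  classical
  induction T using Finset.induction_on generalizing s with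
  | empty => exact ⟨R, by simpa using hR, by simp⟩
  | insert x T hx ih =>
    obtain ⟨R₁, hR₁, h₁⟩ := ih (s + 1)
    obtain ⟨R₂, hR₂, h₂⟩ := exists_family_eulerOp_sub hQ hR₁ (l x) (c x) s
    rw [Finset.card_insert_of_notMem hx]
    refine ⟨R₂, ?_, ?_⟩
    · rwa [mul_add_one, ← add_assoc, ← add_assoc]
    · intro n v
      rw [h₂, add_assoc n s 1, h₁, Finset.prod_insert hx, mul_assoc]
      congr 5
      ring

theorem polyFamilies.pow_mem (hQ : ∀ m ∈ Q.support, ∀ l, m l ≤ q) (j r : ℕ) :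
    (fun n : ℕ => (n : ℚ) ^ j • Q ^ r) ∈ polyFamilies σ (q * r) j := by
  induction r with
  | zero =>
    convert monomial_mem (σ := σ) (d := q * 0) (le_refl j) (s := 0) (by simp) using 1
    funext n
    rw [pow_zero, MvPolynomial.smul_eq_C_mul, mul_one]
    rfl
  | succ r ih =>
    simpa only [pow_succ', mul_smul_comm, mul_add_one] using mul_mem hQ ih

variable [Fintype σ]

theorem exists_family_of_multiIndex (hQ : ∀ m ∈ Q.support, ∀ l, m l ≤ q) {K S i j : ℕ}
    {α : σ → ℕ} (hS : S = Fintype.card σ * K) (hi : i ≤ K) (hj : j ≤ K) (hα : ∀ l, α l ≤ K) :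
    ∃ R ∈ polyFamilies σ (q * (K + S) + 2 * K) (K + S),
      ∀ (n : ℕ) (w : σ →₀ ℕ),
      (Q ^ n * R n).coeff w =
        if ∀ l, 2 * K - i - α l ≤ w l then
          (n : ℚ) ^ j * (∏ l, ∏ t ∈ Finset.range (α l),
            (((w l - (2 * K - i - α l) : ℕ) : ℚ) - (n + (S + i + 1 + t)))) *
          (Q ^ (n + S + i)).coeff
            (w - Finsupp.equivFunOnFinite.symm fun l => 2 * K - i - α l)
        else 0 := by
  classical
  let T : Finset (Σ _ : σ, ℕ) := Finset.univ.sigma fun l => Finset.range (α l)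
  have hT : T.card ≤ S := by
    simp only [T, Finset.card_sigma, Finset.card_range]
    calc ∑ l, α l ≤ ∑ _l : σ, K := Finset.sum_le_sum fun l _ => hα l
      _ = S := by simp [hS]
  -- The `T.card` factors consume that many powers of `Q`; the extra `i + (S - T.card)` powers make
  -- the total `n + S + i`.
  obtain ⟨R, hR, h⟩ := exists_family_prod_eulerOp_sub hQ T (fun x => x.1)
    (fun x => (S : ℚ) + i + 1 + x.2) 0 (polyFamilies.pow_mem hQ j (i + (S - T.card)))
  let u : σ →₀ ℕ := Finsupp.equivFunOnFinite.symm fun l => 2 * K - i - α l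
  have hu : ∀ m ∈ (MvPolynomial.monomial u (1 : ℚ)).support, ∀ l, m l ≤ 2 * K := by
    intro m hm l
    rw [Finset.mem_singleton.1 (MvPolynomial.support_monomial_subset hm)]
    simp only [u, Finsupp.equivFunOnFinite_symm_apply_apply]
    omega
  refine ⟨_, polyFamilies.mono ?_ ?_ (polyFamilies.mul_mem hu hR), ?_⟩
  · rw [← mul_add]
    exact Nat.add_le_add_right (Nat.mul_le_mul_left _ (by omega)) _
  · omega
  · intro n w
    have hle : u ≤ w ↔ ∀ l, 2 * K - i - α l ≤ w l := by
      simp [Finsupp.le_def, u]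
    rw [mul_left_comm, MvPolynomial.coeff_monomial_mul', one_mul]
    simp only [hle]
    refine if_congr Iff.rfl ?_ rfl
    have := h n (w - u)
    rw [add_zero] at this
    rw [this, mul_smul_comm, MvPolynomial.coeff_smul, ← pow_add, Finset.prod_sigma, smul_eq_mul,
      mul_left_comm, mul_assoc, show n + T.card + (i + (S - T.card)) = n + S + i by omega]
    simp [u]

end Euler

/-! ### From a linear relation to a recurrence -/

theorem isHolonomic_of_shifted_sum {a : ℕ → ℚ} {S K : ℕ} (hS : 0 < S) (p : Fin (K + 1) → ℚ[X])
    (hp : ∃ i, p i ≠ 0)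
    (h : ∀ n : ℕ, ∑ i, (p i).eval (n : ℚ) * a (n + S + i) = 0) : IsHolonomic a := by
  classical
  obtain ⟨i₀, hi₀, hmax⟩ := Finset.exists_max_image (Finset.univ.filter fun i => p i ≠ 0) id
    (by simpa [Finset.Nonempty] using hp)
  simp only [Finset.mem_filter, Finset.mem_univ, true_and, id] at hi₀ hmax
  let f : ℕ → ℚ[X] := fun N => if h : N < K + 1 then p ⟨N, h⟩ else 0
  have hf : ∀ i : Fin (K + 1), f i = p i := fun i => dif_pos i.2
  have hf0 : ∀ N, (i₀ : ℕ) < N → f N = 0 := by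
    intro N hN
    by_cases hNK : N < K + 1
    · by_contra hne
      have := hmax ⟨N, hNK⟩ (by simpa only [f, dif_pos hNK] using hne)
      simp only [Fin.le_def] at this
      omega
    · exact dif_neg hNK
  -- The last nonzero `p i₀` leads; coefficients below the shift `S` are zero.
  refine ⟨S + i₀, by omega, fun N => if S ≤ N then f (N - S) else 0, by simpa [hf] using hi₀, ?_⟩
  intro n _
  rw [add_assoc, Finset.sum_range_add, Finset.sum_eq_zero, zero_add]
  · have := h n
    simp only [← hf] at this
    rw [Fin.sum_univ_eq_sum_range (fun i => (f i).eval (n : ℚ) * a (n + S + i)) (K + 1),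
      ← Finset.sum_subset (s₁ := Finset.range (i₀ + 1))] at this
    · simpa [add_assoc] using this
    · intro x hx
      simp only [Finset.mem_range] at hx ⊢
      omega
    · intro x _ hx
      rw [hf0 x (by simpa using hx)]
      simp
  · intro x hx
    have : ¬ S ≤ x := by simpa using hx
    simp [this]

/-! ### Diagonal coefficients of powers -/

section Diagonal

variable {σ : Type*} [Fintype σ]

theorem card_multiIndex_gt (m q : ℕ) : ∃ K, 0 < K ∧
    (K + m * K + 1) * (q * (K + m * K) + 2 * K + 1) ^ m < (K + 1) ^ (m + 2) := by
  -- The left side is at most `(K + 1) ^ (m + 1)` times this constant.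
  refine ⟨(m + 1) * (q * (1 + m) + 2) ^ m, by positivity, ?_⟩
  set K := (m + 1) * (q * (1 + m) + 2) ^ m with hK
  calc (K + m * K + 1) * (q * (K + m * K) + 2 * K + 1) ^ m
      ≤ ((K + 1) * (m + 1)) * ((K + 1) * (q * (1 + m) + 2)) ^ m := by
        gcongr <;> nlinarith [Nat.zero_le (q * (1 + m))]
    _ = (K + 1) ^ (m + 1) * K := by rw [mul_pow, hK]; ring
    _ < (K + 1) ^ (m + 1) * (K + 1) := by gcongr; omega
    _ = (K + 1) ^ (m + 2) := by ring

theorem isHolonomic_diagonal_coeff_pow [Nonempty σ] (Q : MvPolynomial σ ℚ) :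
    IsHolonomic fun n => (Q ^ n).coeff (Finsupp.equivFunOnFinite.symm fun _ => n) := by
  classical
  obtain ⟨q, hQ⟩ : ∃ q, ∀ m ∈ Q.support, ∀ l, m l ≤ q :=
    ⟨Q.totalDegree, fun m hm l => (Finsupp.le_degree l m).trans (MvPolynomial.le_totalDegree hm)⟩
  obtain ⟨K, hK, hcard⟩ := card_multiIndex_gt (Fintype.card σ) q
  let ι := Fin (K + 1) × Fin (K + 1) × (σ → Fin (K + 1))
  obtain ⟨S, hS⟩ : ∃ S, S = Fintype.card σ * K := ⟨_, rfl⟩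
  rw [← hS] at hcard
  choose R hR hcoeff using fun x : ι => exists_family_of_multiIndex hQ hS (i := x.1)
    (j := x.2.1) (α := fun l => x.2.2 l) (by omega) (by omega) (fun l => by omega)
  obtain ⟨hfin, hrank⟩ := polyFamilies.finrank_le (σ := σ) (q * (K + S) + 2 * K) (K + S)
  obtain ⟨c, hc, x₀, hx₀⟩ : ∃ c : ι → ℚ, ∑ x, c x • R x = 0 ∧ ∃ x, c x ≠ 0 := by
    have hdep : ¬ LinearIndependent ℚ
        (fun x : ι => (⟨R x, hR x⟩ : polyFamilies σ (q * (K + S) + 2 * K) (K + S))) := by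
      intro hli
      have := hli.fintype_card_le_finrank.trans hrank
      simp only [ι, Fintype.card_prod, Fintype.card_fin, Fintype.card_fun] at this
      have e : (K + 1) * ((K + 1) * (K + 1) ^ Fintype.card σ) = (K + 1) ^ (Fintype.card σ + 2) := by
        ring
      omega
    obtain ⟨c, hc, hx⟩ := Fintype.not_linearIndependent_iff.1 hdep
    refine ⟨c, ?_, hx⟩
    simpa using congrArg Subtype.val hc
  -- Minimality of `∑ α₀` forces any other `α` in the relation to exceed `α₀` in some variable.
  obtain ⟨x₁, hx₁, hmin⟩ := Finset.exists_min_image (Finset.univ.filter fun x => c x ≠ 0)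
    (fun x : ι => ∑ l, (x.2.2 l : ℕ)) ⟨x₀, by simpa using hx₀⟩
  simp only [Finset.mem_filter, Finset.mem_univ, true_and] at hx₁ hmin
  obtain ⟨i₁, j₁, α₀⟩ := x₁
  let g : ℚ := ∏ l, ∏ t ∈ Finset.range (α₀ l : ℕ), (-1 - (t : ℚ))
  have hg : g ≠ 0 := by
    refine Finset.prod_ne_zero_iff.2 fun l _ => Finset.prod_ne_zero_iff.2 fun t _ => ?_
    have : (0 : ℚ) ≤ t := by positivity
    linarith
  let p : Fin (K + 1) → ℚ[X] := fun i => ∑ j : Fin (K + 1),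
    Polynomial.C (c (i, j, α₀)) * Polynomial.X ^ (j : ℕ)
  refine isHolonomic_of_shifted_sum (S := S) (hS ▸ Nat.mul_pos Fintype.card_pos hK) p ⟨i₁, ?_⟩ ?_
  · intro h0
    have := congrArg (fun f : ℚ[X] => f.coeff j₁) h0
    simp only [p, Polynomial.finsetSum_coeff, Polynomial.coeff_C_mul, Polynomial.coeff_X_pow,
      Polynomial.coeff_zero, Fin.val_inj] at this
    simp at this
    exact hx₁ this
  · intro n
    -- At this exponent `α = α₀` hits the diagonal, with Euler factors `-1 - t`.
    let w : σ →₀ ℕ := Finsupp.equivFunOnFinite.symm fun l => n + S + 2 * K - α₀ l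
    have hw : ∀ l, w l = n + S + 2 * K - α₀ l := fun l => by simp [w]
    have hterm : ∀ x : ι, c x * (Q ^ n * R x n).coeff w = if x.2.2 = α₀ then
        g * (c x * (n : ℚ) ^ (x.2.1 : ℕ) * (Q ^ (n + S + x.1)).coeff
          (Finsupp.equivFunOnFinite.symm fun _ => n + S + x.1)) else 0 := by
      rintro ⟨i, j, α⟩
      rw [hcoeff]
      dsimp only
      by_cases hα : α = α₀
      · subst hα
        rw [if_pos rfl, if_pos (fun l => by have := (α l).2; rw [hw]; omega)]
        have hv : (w - Finsupp.equivFunOnFinite.symm fun l => 2 * K - (i : ℕ) - (α l : ℕ)) =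
            Finsupp.equivFunOnFinite.symm fun _ => n + S + (i : ℕ) := by
          ext l
          have := (α l).2
          have := i.2
          simp [hw]
          omega
        have hprod : (∏ l, ∏ t ∈ Finset.range (α l : ℕ),
            (((w l - (2 * K - i - α l) : ℕ) : ℚ) - (n + (S + i + 1 + t)))) = g := by
          refine Finset.prod_congr rfl fun l _ => Finset.prod_congr rfl fun t _ => ?_
          have h1 := (α l).2
          have h2 := i.2
          rw [hw, show n + S + 2 * K - (α l : ℕ) - (2 * K - i - α l) = n + S + i by omega]
          push_cast
          ring
        rw [hprod, hv]
        ring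
      · rw [if_neg hα]
        by_cases hcx : c (i, j, α) = 0
        · rw [hcx, zero_mul]
        obtain ⟨l, hl⟩ : ∃ l, (α₀ l : ℕ) < α l := by
          by_contra! hle
          refine hα (funext fun l => Fin.ext ?_)
          exact (Finset.sum_eq_sum_iff_of_le fun l _ => hle l).1
            (le_antisymm (Finset.sum_le_sum fun l _ => hle l) (hmin _ hcx)) l (Finset.mem_univ l)
        split_ifs with hle
        · rw [Finset.prod_eq_zero (Finset.mem_univ l)]
          · simp
          -- Here the exponent overshoots the diagonal by `α l - α₀ l`, so this factor vanishes.
          · refine Finset.prod_eq_zero (i := (α l : ℕ) - α₀ l - 1)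
              (Finset.mem_range.2 (by omega)) ?_
            have h1 := (α l).2
            have h2 := i.2
            rw [sub_eq_zero, hw,
              show n + S + 2 * K - (α₀ l : ℕ) - (2 * K - i - α l) =
                n + (S + i + 1 + ((α l : ℕ) - α₀ l - 1)) by omega]
            push_cast
            ring
        · rw [mul_zero]
    have hsum : ∑ x : ι, c x * (Q ^ n * R x n).coeff w = 0 := by
      have := congrArg (fun f : ℕ → MvPolynomial σ ℚ => (Q ^ n * f n).coeff w) hc
      simpa [Finset.mul_sum, MvPolynomial.coeff_sum] using this
    simp only [hterm] at hsum
    rw [← Finset.sum_filter, ← Finset.mul_sum] at hsum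
    have hsum := (mul_eq_zero.1 hsum).resolve_left hg
    rw [Finset.sum_filter, Fintype.sum_prod_type] at hsum
    rw [← hsum]
    refine Finset.sum_congr rfl fun i _ => ?_
    rw [Fintype.sum_prod_type]
    simp [p, Polynomial.eval_finsetSum, Finset.sum_mul]

end Diagonal

/-! ### Balanced matrices as diagonal coefficients -/

/-- The sum of the monomials `∏ i, X i ^ c i` over the `0`-`1` vectors `c` of length `2 * k` with
exactly `k` ones. -/
noncomputable def balancedColumns (k : ℕ) : MvPolynomial (Fin (2 * k)) ℚ :=
  ∑ c ∈ Finset.univ.filter fun c : Fin (2 * k) → Fin 2 =>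
      (Finset.univ.filter fun i => c i = 1).card = k,
    MvPolynomial.monomial (Finsupp.equivFunOnFinite.symm fun i => (c i : ℕ)) 1

theorem balancedCount_eq_coeff (k n : ℕ) : (balancedCount k n : ℚ) =
    ((balancedColumns k ^ 2) ^ n).coeff (Finsupp.equivFunOnFinite.symm fun _ => n) := by
  classical
  have hval : ∀ {m : ℕ} (c : Fin m → Fin 2),
      ∑ j, (c j : ℕ) = (Finset.univ.filter fun j => c j = 1).card := by
    intro m c
    rw [Finset.card_filter]
    refine Finset.sum_congr rfl fun j _ => ?_
    generalize c j = x
    fin_cases x <;> rfl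
  rw [← pow_mul, ← Fintype.card_fin (2 * n), ← Finset.card_univ, ← Finset.prod_const,
    balancedColumns, Finset.prod_univ_sum, MvPolynomial.coeff_sum]
  have hmon : ∀ f : Fin (2 * n) → Fin (2 * k) → Fin 2,
      (∏ j, MvPolynomial.monomial (Finsupp.equivFunOnFinite.symm fun i => (f j i : ℕ))
        (1 : ℚ)).coeff (Finsupp.equivFunOnFinite.symm fun _ => n) =
      if ∀ i, (Finset.univ.filter fun j => f j i = 1).card = n then 1 else 0 := by
    intro f
    rw [← MvPolynomial.monomial_sum_one, MvPolynomial.coeff_monomial]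
    refine if_congr ?_ rfl rfl
    simp [Finsupp.ext_iff, Finsupp.finsetSum_apply, hval]
  simp only [hmon]
  rw [← Finset.sum_filter, Finset.sum_const, nsmul_one, balancedCount]
  congr 1
  refine Finset.card_bij (fun A _ j i => A i j) ?_ ?_ ?_
  · intro A hA
    have h := (Finset.mem_filter.1 hA).2
    exact Finset.mem_filter.2 ⟨Fintype.mem_piFinset.2 fun j =>
      Finset.mem_filter.2 ⟨Finset.mem_univ _, h.2 j⟩, h.1⟩
  · intro A _ B _ h
    funext i j
    exact congrFun (congrFun h j) i
  · intro f hf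
    have h := Finset.mem_filter.1 hf
    exact ⟨fun i j => f j i, Finset.mem_filter.2 ⟨Finset.mem_univ _, h.2, fun j =>
      (Finset.mem_filter.1 (Fintype.mem_piFinset.1 h.1 j)).2⟩, rfl⟩

theorem theorem1 (k : ℕ) (hk : 0 < k) :
    IsHolonomic (fun n => (balancedCount k n : ℚ)) := by
  have : Nonempty (Fin (2 * k)) := ⟨⟨0, by omega⟩⟩
  simpa only [balancedCount_eq_coeff] using isHolonomic_diagonal_coeff_pow (balancedColumns k ^ 2)
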